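/- Let $\mathfrak t$ be a finite-dimensional real vector space, $\check\Lambda\subset\mathfrak t$ a lattice of full rank and $T=\mathfrak t/\check\Lambda$. Let $J$ be an integer-valued bilinear form on $\check\Lambda$, extended to a real bilinear form on $\mathfrak t$, and put $I(x,y)=J(x,y)+J(y,x)$. Write $\exp(r)=e^{2\pi i r}$ for $r\in\mathbb R$. Let $\mathcal LT$ be the group of continuous, piecewise smooth loops $\mathbb R/\mathbb Z\to T$, and $\Omega T$ the subgroup of loops with value $0$ at $0$. For loops $\varphi,\gamma$ choose continuous piecewise smooth lifts $f,g:\mathbb R\to\mathfrak t$, and write $\Delta_f=f(1)-f(0)\in\check\Lambda$. Then $$c(\varphi,\gamma)=\exp\Big(\int_0^1 J(f(t),\dot g(t))\,dt\Big)$$ is a well-defined $U(1)$-valued 2-cocycle on $\mathcal LT$. Let $b$ be an integer-valued bilinear form on $\check\Lambda$ with $b(m,n)+b(n,m)\equiv I(m,n) \pmod 2$ for all $m,n$ (for instance $b=J$). The Pressley--Segal extension of $\mathcal LT$ for the form $\langle\cdot,\cdot\rangle=I$ is the central extension by $U(1)$ with the (well-defined) 2-cocycle $$c_{PS}(\varphi,\gamma)=(-1)^{b(\Delta_f,\Delta_g)}\exp\Big(\tfrac12\int_0^1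 I(f(t),\dot g(t))\,dt+\tfrac12 I(f(0),\Delta_g)\Big).$$ **Lemma.** (i) Let $\mathbf L=(\mathbb C\times\mathfrak t\times\mathfrak t)/\!\sim$ be the line bundle over $T\times T$ with $(z,x,y)\sim(z\exp(J(m,y)),x+m,y+n)$ for $m,n\in\check\Lambda$, and let $\nabla=d+2\pi i\,\omega$ be its connection with 1-form $\omega_{(x,y)}(v,w)=-J(x,w)$. For $\varphi,\gamma\in\Omega T$, the holonomy of $(\mathbf L,\nabla)$ around $(\varphi,\gamma)$ is $c(\varphi,\gamma)$. (ii) The central extension $\widetilde{\Omega T}$ of $\Omega T$ by $U(1)$ defined by the restriction of $c$ is isomorphic to the restriction of the Pressley--Segal extension to $\Omega T$: there is a group isomorphism that is the identity on $U(1)$, covers the identity of $\Omega T$, and is smooth together with its inverse. (iii) The same holds with $\Omega T$ replaced by the group of smooth based loops. Here the extension defined by a 2-cocycle has underlying space $U(1)\times\Omega T$, and a map is smooth if it takes smooth families with parameter space $\mathbb R^n$, $n\ge 0$, to smooth families. A family in $U(1)\times\Omega T$ is smooth if both components are; a family of loops $(\varphi_u)_{u\in\mathbb R^n}$ is smooth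 if it has a continuous family of lifts $F(u,t)\in\mathfrak t$ that is jointly smooth in $(u,t)$ on $\mathbb R^n\times[t_{i-1},t_i]$ for some subdivision $0=t_0<\dots<t_k=1$ (in (iii): jointly smooth on $\mathbb R^n\times\mathbb R$). -/

import Mathlib

open Set Filter Topology MeasureTheory
open scoped ContDiff FourierTransform

noncomputable section

namespace LoopTorus

/-! ## Bilinear forms on a lattice `L` and their real bilinear extension to `V`

Here `V` is the Lie algebra of the torus `V ⧸ L`. Throughout, `𝐞 r = e ^ (2 π i r)`. -/

section Forms

variable {V : Type*} [NormedAddCommGroup V] [NormedSpace ℝ V] [FiniteDimensional ℝ V]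

/-- Some `ℤ`-basis of the lattice `L`. -/
def latticeBasis (L : Submodule ℤ V) [DiscreteTopology L] [IsZLattice ℝ L] :
    Module.Basis (Module.Free.ChooseBasisIndex ℤ L) ℤ L :=
  haveI : Module.Free ℤ L := ZLattice.module_free ℝ L
  Module.Free.chooseBasis ℤ L

/-- The `ℝ`-linear map `V → W` that extends an additive map `L → W`. -/
def extendLinear (L : Submodule ℤ V) [DiscreteTopology L] [IsZLattice ℝ L]
    {W : Type*} [AddCommGroup W] [Module ℝ W] (φ : L → W) : V →ₗ[ℝ] W :=
  ((latticeBasis L).ofZLatticeBasis ℝ L).constr ℝ (fun i => φ (latticeBasis L i))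

theorem extendLinear_coe (L : Submodule ℤ V) [DiscreteTopology L] [IsZLattice ℝ L]
    {W : Type*} [AddCommGroup W] [Module ℝ W] (φ : L →ₗ[ℤ] W) (m : L) :
    extendLinear L φ (m : V) = φ m := by
  have h : ((extendLinear L φ).restrictScalars ℤ) ∘ₗ L.subtype = φ := by
    refine (latticeBasis L).ext fun i => ?_
    have := ((latticeBasis L).ofZLatticeBasis ℝ L).constr_basis ℝ
      (fun i => φ (latticeBasis L i)) i
    rw [Module.Basis.ofZLatticeBasis_apply] at this
    exact this
  exact LinearMap.congr_fun h m

/-- The real bilinear form on `V` extending an integer valued bilinear form `J` on `L`. -/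
def realForm {L : Submodule ℤ V} [DiscreteTopology L] [IsZLattice ℝ L]
    (J : L →ₗ[ℤ] L →ₗ[ℤ] ℤ) : V →ₗ[ℝ] V →ₗ[ℝ] ℝ :=
  extendLinear L (fun m : L => extendLinear L (fun n : L => ((J m n : ℤ) : ℝ)))

theorem realForm_coe {L : Submodule ℤ V} [DiscreteTopology L] [IsZLattice ℝ L]
    (J : L →ₗ[ℤ] L →ₗ[ℤ] ℤ) (m n : L) : realForm J (m : V) (n : V) = (J m n : ℝ) := by
  have h1 : ∀ m n : L, extendLinear L (fun n : L => ((J m n : ℤ) : ℝ)) (n : V) = (J m n : ℝ) :=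
    fun m n => extendLinear_coe L ((Algebra.linearMap ℤ ℝ) ∘ₗ (J m)) n
  have h2 : ∀ m m' : L, extendLinear L (fun n : L => ((J (m + m') n : ℤ) : ℝ))
      = extendLinear L (fun n : L => ((J m n : ℤ) : ℝ))
        + extendLinear L (fun n : L => ((J m' n : ℤ) : ℝ)) := fun m m' => by
    refine ((latticeBasis L).ofZLatticeBasis ℝ L).ext fun i => ?_
    rw [Module.Basis.ofZLatticeBasis_apply, LinearMap.add_apply, h1, h1, h1]
    simp
  let Φ : L →+ (V →ₗ[ℝ] ℝ) :=
    AddMonoidHom.mk' (fun m => extendLinear L (fun n : L => ((J m n : ℤ) : ℝ))) h2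
  have h3 : realForm J (m : V) = Φ m := extendLinear_coe L Φ.toIntLinearMap m
  rw [h3]
  exact h1 m n

/-- The even symmetric bilinear form `I(x, y) = J(x, y) + J(y, x)`. -/
def symForm {L : Submodule ℤ V} [DiscreteTopology L] [IsZLattice ℝ L]
    (J : L →ₗ[ℤ] L →ₗ[ℤ] ℤ) : V →ₗ[ℝ] V →ₗ[ℝ] ℝ :=
  realForm J + (realForm J).flip

theorem fourierChar_intCast (k : ℤ) : 𝐞 (k : ℝ) = (1 : Circle) := by
  ext
  rw [Real.fourierChar_apply, Circle.coe_one, Complex.exp_eq_one_iff]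
  exact ⟨k, by push_cast; ring⟩

end Forms

/-! ## Piecewise smooth loops -/

section Loops

variable {V : Type*} [NormedAddCommGroup V] [NormedSpace ℝ V]

/-- `f` is smooth on each closed interval of a finite subdivision of `[0, 1]`; the finite set `P`
holds the subdivision points. -/
def PiecewiseSmooth (f : ℝ → V) : Prop :=
  ∃ P : Finset ℝ, ∀ a b : ℝ, 0 ≤ a → a < b → b ≤ 1 → (∀ p ∈ P, p ∉ Ioo a b) →
    ContDiffOn ℝ ∞ f (Icc a b)

/-- A continuous, piecewise smooth lift `f` of the loop `γ : ℝ / ℤ → V ⧸ L` to `V`. -/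
structure IsLift (L : Submodule ℤ V) (γ : UnitAddCircle → V ⧸ L) (f : ℝ → V) : Prop where
  continuous : Continuous f
  lifts : ∀ t : ℝ, (Submodule.Quotient.mk (f t) : V ⧸ L) = γ (t : UnitAddCircle)
  piecewiseSmooth : PiecewiseSmooth f

theorem PiecewiseSmooth.add {f g : ℝ → V} (hf : PiecewiseSmooth f) (hg : PiecewiseSmooth g) :
    PiecewiseSmooth (fun t => f t + g t) := by
  classical
  obtain ⟨P, hP⟩ := hf
  obtain ⟨Q, hQ⟩ := hg
  refine ⟨P ∪ Q, fun a b h0 hab h1 h => ?_⟩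
  exact (hP a b h0 hab h1 fun p hp => h p (Finset.mem_union_left _ hp)).add
    (hQ a b h0 hab h1 fun p hp => h p (Finset.mem_union_right _ hp))

theorem PiecewiseSmooth.neg {f : ℝ → V} (hf : PiecewiseSmooth f) :
    PiecewiseSmooth (fun t => - f t) := by
  obtain ⟨P, hP⟩ := hf
  exact ⟨P, fun a b h0 hab h1 h => (hP a b h0 hab h1 h).neg⟩

theorem PiecewiseSmooth.const (v : V) : PiecewiseSmooth (fun _ => v) :=
  ⟨∅, fun _ _ _ _ _ _ => contDiffOn_const⟩

theorem IsLift.add {L : Submodule ℤ V} {φ γ : UnitAddCircle → V ⧸ L} {f g : ℝ → V}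
    (hf : IsLift L φ f) (hg : IsLift L γ g) : IsLift L (φ + γ) (fun t => f t + g t) :=
  ⟨hf.continuous.add hg.continuous, fun t => by
    rw [Submodule.Quotient.mk_add, hf.lifts, hg.lifts, Pi.add_apply],
    hf.piecewiseSmooth.add hg.piecewiseSmooth⟩

theorem IsLift.neg {L : Submodule ℤ V} {φ : UnitAddCircle → V ⧸ L} {f : ℝ → V}
    (hf : IsLift L φ f) : IsLift L (-φ) (fun t => - f t) :=
  ⟨hf.continuous.neg, fun t => by
    rw [Submodule.Quotient.mk_neg, hf.lifts, Pi.neg_apply], hf.piecewiseSmooth.neg⟩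

/-- The group of piecewise smooth loops in the torus `V ⧸ L`, under pointwise addition. Since
`V → V ⧸ L` is the universal covering and a local diffeomorphism, a loop is continuous and
piecewise smooth if and only if it has a continuous piecewise smooth lift. -/
def loopGroup (L : Submodule ℤ V) : AddSubgroup (UnitAddCircle → V ⧸ L) where
  carrier := {γ | ∃ f, IsLift L γ f}
  zero_mem' := ⟨fun _ => 0, continuous_const, fun _ => rfl, PiecewiseSmooth.const 0⟩
  add_mem' := by
    rintro φ γ ⟨f, hf⟩ ⟨g, hg⟩
    exact ⟨_, hf.add hg⟩
  neg_mem' := by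
    rintro φ ⟨f, hf⟩
    exact ⟨_, hf.neg⟩

/-- The piecewise smooth loops based at the neutral element. -/
def basedLoops (L : Submodule ℤ V) : AddSubgroup (loopGroup L) where
  carrier := {γ | γ.1 0 = 0}
  zero_mem' := rfl
  add_mem' := fun {φ γ} hφ hγ => by
    have h1 : φ.1 0 = 0 := hφ
    have h2 : γ.1 0 = 0 := hγ
    change φ.1 0 + γ.1 0 = 0
    rw [h1, h2, add_zero]
  neg_mem' := fun {φ} hφ => by
    have h1 : φ.1 0 = 0 := hφ
    change - φ.1 0 = 0
    rw [h1, neg_zero]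

/-- The smooth loops based at the neutral element. -/
def smoothBasedLoops (L : Submodule ℤ V) : AddSubgroup (loopGroup L) where
  carrier := {γ | γ.1 0 = 0 ∧ ∃ f, IsLift L γ.1 f ∧ ContDiff ℝ ∞ f}
  zero_mem' := ⟨rfl, fun _ => 0, ⟨continuous_const, fun _ => rfl, PiecewiseSmooth.const 0⟩,
    contDiff_const⟩
  add_mem' := fun {φ γ} hφ hγ => by
    obtain ⟨f, hf, hf'⟩ := hφ.2
    obtain ⟨g, hg, hg'⟩ := hγ.2
    exact ⟨(basedLoops L).add_mem hφ.1 hγ.1, _, hf.add hg, hf'.add hg'⟩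
  neg_mem' := fun {φ} hφ => by
    obtain ⟨f, hf, hf'⟩ := hφ.2
    exact ⟨(basedLoops L).neg_mem hφ.1, _, hf.neg, hf'.neg⟩

/-- A smooth finite-dimensional family of piecewise smooth loops: locally in the parameter (and
the parameter space is a ball, up to diffeomorphism) it lifts to a continuous family of paths in
`V` that is jointly smooth in the parameter and the time on each closed interval of a finite
subdivision of `[0, 1]`. -/
def IsSmoothFamily (L : Submodule ℤ V) (A : AddSubgroup (loopGroup L)) (n : ℕ)
    (p : EuclideanSpace ℝ (Fin n) → A) : Prop :=
  ∃ F : EuclideanSpace ℝ (Fin n) × ℝ → V, Continuous F ∧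
    (∀ u t, (Submodule.Quotient.mk (F (u, t)) : V ⧸ L) = (p u).1.1 (t : UnitAddCircle)) ∧
    ∃ P : Finset ℝ, ∀ a b : ℝ, 0 ≤ a → a < b → b ≤ 1 → (∀ q ∈ P, q ∉ Ioo a b) →
      ContDiffOn ℝ ∞ F (univ ×ˢ Icc a b)

/-- A smooth finite-dimensional family of smooth loops: it lifts to a family of paths in `V` that
is jointly smooth in the parameter and the time. -/
def IsSmoothFamily' (L : Submodule ℤ V) (A : AddSubgroup (loopGroup L)) (n : ℕ)
    (p : EuclideanSpace ℝ (Fin n) → A) : Prop :=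
  ∃ F : EuclideanSpace ℝ (Fin n) × ℝ → V, ContDiff ℝ ∞ F ∧
    ∀ u t, (Submodule.Quotient.mk (F (u, t)) : V ⧸ L) = (p u).1.1 (t : UnitAddCircle)

end Loops

/-! ## Central extensions by `U(1)` defined by a 2-cocycle -/

section Extensions

/-- A 2-cocycle on the abelian group `A` with values in `U(1)`. -/
structure CircleCocycle (A : Type*) [AddCommGroup A] where
  /-- The underlying function. -/
  toFun : A → A → Circle
  cocycle : ∀ x y z : A, toFun x y * toFun (x + y) z = toFun y z * toFun x (y + z)

namespace CircleCocycle

variable {A : Type*} [AddCommGroup A]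

theorem zero_left (c : CircleCocycle A) (x : A) : c.toFun 0 x = c.toFun 0 0 := by
  have := c.cocycle 0 0 x
  simp only [zero_add] at this
  exact (mul_right_cancel this).symm

theorem zero_right (c : CircleCocycle A) (x : A) : c.toFun x 0 = c.toFun 0 0 := by
  have := c.cocycle x 0 0
  simp only [add_zero] at this
  exact mul_right_cancel this

/-- The restriction of a cocycle to a subgroup. -/
def restrict (c : CircleCocycle A) (B : AddSubgroup A) : CircleCocycle B where
  toFun x y := c.toFun x y
  cocycle x y z := c.cocycle x y z

/-- The underlying set `U(1) × A` of the central extension of `A` by `U(1)` with cocycle `c`. -/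
@[ext]
structure Extension (c : CircleCocycle A) where
  /-- The component in `U(1)`. -/
  coord : Circle
  /-- The component in `A`. -/
  base : A

namespace Extension

variable {c : CircleCocycle A}

/-- `(z, x) (w, y) = (z w c(x, y), x + y)`. -/
instance : Mul c.Extension :=
  ⟨fun x y => ⟨x.coord * y.coord * c.toFun x.base y.base, x.base + y.base⟩⟩

instance : One c.Extension := ⟨⟨(c.toFun 0 0)⁻¹, 0⟩⟩

instance : Inv c.Extension :=
  ⟨fun x => ⟨x.coord⁻¹ * (c.toFun (-x.base) x.base)⁻¹ * (c.toFun 0 0)⁻¹, -x.base⟩⟩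

theorem mul_coord (x y : c.Extension) :
    (x * y).coord = x.coord * y.coord * c.toFun x.base y.base := rfl

theorem mul_base (x y : c.Extension) : (x * y).base = x.base + y.base := rfl

theorem one_coord : (1 : c.Extension).coord = (c.toFun 0 0)⁻¹ := rfl

theorem one_base : (1 : c.Extension).base = 0 := rfl

theorem inv_coord (x : c.Extension) :
    x⁻¹.coord = x.coord⁻¹ * (c.toFun (-x.base) x.base)⁻¹ * (c.toFun 0 0)⁻¹ := rfl

theorem inv_base (x : c.Extension) : x⁻¹.base = -x.base := rfl

instance : Group c.Extension :=
  Group.ofLeftAxioms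
    (fun x y z => by
      apply Extension.ext
      · simp only [mul_coord, mul_base]
        have := c.cocycle x.base y.base z.base
        calc _ = x.coord * y.coord * z.coord *
              (c.toFun x.base y.base * c.toFun (x.base + y.base) z.base) := by
              simp only [mul_assoc, mul_comm, mul_left_comm]
          _ = _ := by
              rw [this]
              simp only [mul_assoc, mul_comm, mul_left_comm]
      · simp only [mul_base, add_assoc])
    (fun x => by
      apply Extension.ext
      · simp only [mul_coord, one_coord, one_base, c.zero_left x.base]
        rw [mul_right_comm, inv_mul_cancel, one_mul]
      · simp only [mul_base, one_base, zero_add])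
    (fun x => by
      apply Extension.ext
      · simp only [mul_coord, one_coord, inv_coord, inv_base]
        calc _ = (x.coord⁻¹ * x.coord) *
              ((c.toFun (-x.base) x.base)⁻¹ * c.toFun (-x.base) x.base) * (c.toFun 0 0)⁻¹ := by
              simp only [mul_assoc, mul_comm, mul_left_comm]
          _ = _ := by rw [inv_mul_cancel, inv_mul_cancel, one_mul, one_mul]
      · simp only [mul_base, one_base, inv_base, neg_add_cancel])

/-- The inclusion of the central `U(1)`. -/
def incl (c : CircleCocycle A) : Circle →* c.Extension where
  toFun z := ⟨z * (c.toFun 0 0)⁻¹, 0⟩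
  map_one' := by
    apply Extension.ext
    · simp only [one_coord, one_mul]
    · rfl
  map_mul' z w := by
    apply Extension.ext
    · simp only [mul_coord]
      calc z * w * (c.toFun 0 0)⁻¹ = z * w * (c.toFun 0 0)⁻¹ * ((c.toFun 0 0)⁻¹ * c.toFun 0 0) := by
            rw [inv_mul_cancel, mul_one]
        _ = _ := by simp only [mul_assoc, mul_comm, mul_left_comm]
    · simp only [mul_base, add_zero]

/-- The projection to `A`. -/
def proj (c : CircleCocycle A) : c.Extension →* Multiplicative A where
  toFun x := Multiplicative.ofAdd x.base
  map_one' := rfl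
  map_mul' _ _ := rfl

end Extension

/-- An isomorphism of the central extensions of `A` by `U(1)` with cocycles `c` and `c'`: a group
isomorphism over the identity of `A` and under the identity of `U(1)` which is smooth together
with its inverse. Smoothness is meant with respect to a given notion `S` of smooth families
`ℝⁿ → A`, for all `n`: a family in an extension, whose underlying space is `U(1) × A`, is smooth
if its two components are, and a map is smooth if it takes smooth families to smooth families. -/
structure ExtensionIso (c c' : CircleCocycle A)
    (S : ∀ n : ℕ, (EuclideanSpace ℝ (Fin n) → A) → Prop) where
  /-- The group isomorphism. -/
  toMulEquiv : c.Extension ≃* c'.Extension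
  map_incl : ∀ z : Circle, toMulEquiv (Extension.incl c z) = Extension.incl c' z
  proj_map : ∀ x, Extension.proj c' (toMulEquiv x) = Extension.proj c x
  smooth : ∀ (n : ℕ) (e : EuclideanSpace ℝ (Fin n) → c.Extension),
    ContDiff ℝ ∞ (fun u => ((e u).coord : ℂ)) → S n (fun u => (e u).base) →
    ContDiff ℝ ∞ (fun u => ((toMulEquiv (e u)).coord : ℂ)) ∧
      S n (fun u => (toMulEquiv (e u)).base)
  smooth_symm : ∀ (n : ℕ) (e : EuclideanSpace ℝ (Fin n) → c'.Extension),
    ContDiff ℝ ∞ (fun u => ((e u).coord : ℂ)) → S n (fun u => (e u).base) →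
    ContDiff ℝ ∞ (fun u => ((toMulEquiv.symm (e u)).coord : ℂ)) ∧
      S n (fun u => (toMulEquiv.symm (e u)).base)

end CircleCocycle

end Extensions

/-! ## Integrals along piecewise smooth paths -/

section Integrals

variable {V : Type*} [NormedAddCommGroup V] [NormedSpace ℝ V]

theorem PiecewiseSmooth.exists_differentiableAt {g : ℝ → V} (hg : PiecewiseSmooth g) :
    ∃ P : Finset ℝ, ∀ t ∈ Ioo (0 : ℝ) 1, t ∉ P → DifferentiableAt ℝ g t := by
  obtain ⟨P, hP⟩ := hg
  refine ⟨P, fun t ht htP => ?_⟩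
  have ho : IsOpen (Ioo (0 : ℝ) 1 ∩ (P : Set ℝ)ᶜ) :=
    isOpen_Ioo.inter P.finite_toSet.isClosed.isOpen_compl
  obtain ⟨ε, hε, hb⟩ := Metric.isOpen_iff.1 ho t ⟨ht, htP⟩
  have hsub : ∀ s ∈ Icc (t - ε / 2) (t + ε / 2), s ∈ Ioo (0 : ℝ) 1 ∩ (P : Set ℝ)ᶜ := fun s hs => by
    refine hb ?_
    rw [Metric.mem_ball, Real.dist_eq, abs_lt]
    constructor <;> linarith [hs.1, hs.2]
  have h1 := hsub (t - ε / 2) ⟨le_rfl, by linarith⟩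
  have h2 := hsub (t + ε / 2) ⟨by linarith, le_rfl⟩
  have hc := hP (t - ε / 2) (t + ε / 2) h1.1.1.le (by linarith) h2.1.2.le
    (fun p hp hpI => (hsub p ⟨hpI.1.le, hpI.2.le⟩).2 hp)
  exact (hc.differentiableOn (by simp)).differentiableAt
    (Icc_mem_nhds (by linarith) (by linarith))

variable [FiniteDimensional ℝ V]

theorem intervalIntegrable_form (K : V →ₗ[ℝ] V →ₗ[ℝ] ℝ) {f g : ℝ → V} (hf : Continuous f)
    (hg : PiecewiseSmooth g) :
    IntervalIntegrable (fun t => K (f t) (deriv g t)) volume 0 1 := by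
  classical
  obtain ⟨P, hP⟩ := hg
  have key : ∀ (k : ℕ) (a b : ℝ), 0 ≤ a → a ≤ b → b ≤ 1 →
      (P.filter (fun p => p ∈ Ioo a b)).card = k →
      IntervalIntegrable (fun t => K (f t) (deriv g t)) volume a b := by
    intro k
    induction k using Nat.strong_induction_on with
    | _ k ih =>
      intro a b h0 hab h1 hk
      rcases hab.eq_or_lt with rfl | hlt
      · exact IntervalIntegrable.refl
      by_cases hne : ∃ p ∈ P, p ∈ Ioo a b
      · obtain ⟨p, hp, hpI⟩ := hne
        have hcard : ∀ a' b', a ≤ a' → b' ≤ b → p ∉ Ioo a' b' →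
            (P.filter (fun q => q ∈ Ioo a' b')).card < k := by
          intro a' b' ha hb hpn
          rw [← hk]
          refine Finset.card_lt_card (Finset.ssubset_iff_of_subset ?_ |>.2 ⟨p, ?_, ?_⟩)
          · intro q hq
            rw [Finset.mem_filter] at hq ⊢
            exact ⟨hq.1, lt_of_le_of_lt ha hq.2.1, lt_of_lt_of_le hq.2.2 hb⟩
          · exact Finset.mem_filter.2 ⟨hp, hpI⟩
          · exact fun h => hpn (Finset.mem_filter.1 h).2
        exact (ih _ (hcard a p le_rfl hpI.2.le fun h => lt_irrefl _ h.2) a p h0 hpI.1.le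
          (hpI.2.le.trans h1) rfl).trans
          (ih _ (hcard p b hpI.1.le le_rfl fun h => lt_irrefl _ h.1) p b (h0.trans hpI.1.le)
          hpI.2.le h1 rfl)
      · push Not at hne
        have hc := hP a b h0 hlt h1 hne
        have hd := hc.continuousOn_derivWithin (uniqueDiffOn_Icc hlt) (by simp)
        have hcont : ContinuousOn (fun t => K (f t) (derivWithin g (Icc a b) t)) (Icc a b) := by
          have : ContinuousOn (fun t => K.toContinuousBilinearMap (f t)
              (derivWithin g (Icc a b) t)) (Icc a b) :=
            (K.toContinuousBilinearMap.continuous.comp_continuousOn hf.continuousOn).clm_apply hd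
          exact this
        rw [← uIcc_of_le hab] at hcont
        refine hcont.intervalIntegrable.congr_uIoo fun t ht => ?_
        rw [uIoo_of_le hab] at ht
        change K (f t) (derivWithin g (uIcc a b) t) = K (f t) (deriv g t)
        rw [uIcc_of_le hab, derivWithin_of_mem_nhds (Icc_mem_nhds ht.1 ht.2)]
  exact key _ 0 1 le_rfl zero_le_one le_rfl rfl

/-- `∫₀¹ K(f(t), g'(t)) dt`. -/
def pairing (K : V →ₗ[ℝ] V →ₗ[ℝ] ℝ) (f g : ℝ → V) : ℝ :=
  ∫ t in (0 : ℝ)..1, K (f t) (deriv g t)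

theorem pairing_add_left (K : V →ₗ[ℝ] V →ₗ[ℝ] ℝ) {f₁ f₂ g : ℝ → V} (h₁ : Continuous f₁)
    (h₂ : Continuous f₂) (hg : PiecewiseSmooth g) :
    pairing K (fun t => f₁ t + f₂ t) g = pairing K f₁ g + pairing K f₂ g := by
  unfold pairing
  rw [← intervalIntegral.integral_add (intervalIntegrable_form K h₁ hg)
    (intervalIntegrable_form K h₂ hg)]
  simp only [map_add, LinearMap.add_apply]

theorem pairing_add_right (K : V →ₗ[ℝ] V →ₗ[ℝ] ℝ) {f g₁ g₂ : ℝ → V} (hf : Continuous f)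
    (h₁ : PiecewiseSmooth g₁) (h₂ : PiecewiseSmooth g₂) :
    pairing K f (fun t => g₁ t + g₂ t) = pairing K f g₁ + pairing K f g₂ := by
  unfold pairing
  rw [← intervalIntegral.integral_add (intervalIntegrable_form K hf h₁)
    (intervalIntegrable_form K hf h₂)]
  obtain ⟨P, hP⟩ := h₁.exists_differentiableAt
  obtain ⟨Q, hQ⟩ := h₂.exists_differentiableAt
  refine intervalIntegral.integral_congr_ae ?_
  have hfin : ((P : Set ℝ) ∪ Q ∪ {1}).Countable :=
    ((P.countable_toSet.union Q.countable_toSet).union (countable_singleton _))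
  filter_upwards [hfin.ae_notMem volume] with t ht htI
  rw [uIoc_of_le zero_le_one] at htI
  simp only [mem_union, Finset.mem_coe, mem_singleton_iff, not_or] at ht
  have htI' : t ∈ Ioo (0 : ℝ) 1 := ⟨htI.1, lt_of_le_of_ne htI.2 ht.2⟩
  have := deriv_fun_add (hP t htI' ht.1.1) (hQ t htI' ht.1.2)
  rw [this, map_add]

theorem pairing_const_left (K : V →ₗ[ℝ] V →ₗ[ℝ] ℝ) (v : V) {g : ℝ → V} (hg : Continuous g)
    (hg' : PiecewiseSmooth g) : pairing K (fun _ => v) g = K v (g 1 - g 0) := by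
  obtain ⟨P, hP⟩ := hg'.exists_differentiableAt
  have hK : Continuous (K v) := LinearMap.continuous_of_finiteDimensional _
  rw [map_sub]
  unfold pairing
  refine integral_eq_of_hasDerivAt_off_countable_of_le (fun t => K v (g t)) _ zero_le_one
    P.countable_toSet (hK.comp hg).continuousOn (fun t ht => ?_)
    (intervalIntegrable_form K continuous_const hg')
  exact ((LinearMap.toContinuousLinearMap (K v)).hasFDerivAt.comp_hasDerivAt t
    (hP t ht.1 ht.2).hasDerivAt)

theorem pairing_const_right (K : V →ₗ[ℝ] V →ₗ[ℝ] ℝ) (f : ℝ → V) (v : V) :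
    pairing K f (fun _ => v) = 0 := by
  simp [pairing]

end Integrals

/-! ## The cocycles -/

section Cocycles

variable {V : Type*} [NormedAddCommGroup V] [NormedSpace ℝ V] {L : Submodule ℤ V}

/-- A lift of a loop. -/
def lift (γ : loopGroup L) : ℝ → V := γ.2.choose

theorem isLift_lift (γ : loopGroup L) : IsLift L γ.1 (lift γ) := γ.2.choose_spec

theorem IsLift.eq_add [DiscreteTopology L] {γ : UnitAddCircle → V ⧸ L} {f f' : ℝ → V}
    (hf : IsLift L γ f) (hf' : IsLift L γ f') : ∃ m : L, f' = fun t => f t + (m : V) := by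
  have hmem : ∀ t, f' t - f t ∈ L := fun t => by
    rw [← Submodule.Quotient.eq, hf.lifts, hf'.lifts]
  let d : ℝ → L := fun t => ⟨f' t - f t, hmem t⟩
  have hd : Continuous d := (hf'.continuous.sub hf.continuous).subtype_mk _
  refine ⟨d 0, funext fun t => ?_⟩
  have h : d t = d 0 := PreconnectedSpace.constant inferInstance hd
  rw [← h]
  simp [d]

theorem IsLift.sub_mem {γ : UnitAddCircle → V ⧸ L} {f : ℝ → V} (hf : IsLift L γ f) :
    f 1 - f 0 ∈ L := by
  rw [← Submodule.Quotient.eq, hf.lifts, hf.lifts]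
  congr 1
  simp

/-- Expressions `S(f, g)` in lifts `f`, `g` of loops which are additive in each variable and
integral if one variable is constant with value in `L`. For such `S` the number `𝐞 (S f g)`
depends on the loops only, and it is a 2-cocycle. -/
structure IsAdmissible (L : Submodule ℤ V) (S : (ℝ → V) → (ℝ → V) → ℝ) : Prop where
  add_left : ∀ {φ φ' γ : loopGroup L} {f f' g : ℝ → V}, IsLift L φ.1 f → IsLift L φ'.1 f' →
    IsLift L γ.1 g → S (fun t => f t + f' t) g = S f g + S f' g
  add_right : ∀ {φ γ γ' : loopGroup L} {f g g' : ℝ → V}, IsLift L φ.1 f → IsLift L γ.1 g →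
    IsLift L γ'.1 g' → S f (fun t => g t + g' t) = S f g + S f g'
  const_left : ∀ {γ : loopGroup L} {g : ℝ → V}, IsLift L γ.1 g → ∀ m : L,
    ∃ k : ℤ, S (fun _ => (m : V)) g = k
  const_right : ∀ {φ : loopGroup L} {f : ℝ → V}, IsLift L φ.1 f → ∀ m : L,
    ∃ k : ℤ, S f (fun _ => (m : V)) = k

theorem isLift_const (m : L) : IsLift L (0 : loopGroup L).1 (fun _ => (m : V)) :=
  ⟨continuous_const, fun _ => (Submodule.Quotient.mk_eq_zero L).2 m.2, PiecewiseSmooth.const _⟩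

theorem IsAdmissible.lift_eq [DiscreteTopology L] {S : (ℝ → V) → (ℝ → V) → ℝ}
    (hS : IsAdmissible L S) {φ γ : loopGroup L} {f g : ℝ → V} (hf : IsLift L φ.1 f)
    (hg : IsLift L γ.1 g) : 𝐞 (S (lift φ) (lift γ)) = 𝐞 (S f g) := by
  obtain ⟨m, hm⟩ := (isLift_lift φ).eq_add hf
  obtain ⟨n, hn⟩ := (isLift_lift γ).eq_add hg
  obtain ⟨k, hk⟩ := hS.const_left hg m
  obtain ⟨l, hl⟩ := hS.const_right (isLift_lift φ) n
  have h1 : S f g = S (lift φ) g + k := by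
    rw [← hk, ← hS.add_left (isLift_lift φ) (isLift_const m) hg, ← hm]
  have h2 : S (lift φ) g = S (lift φ) (lift γ) + l := by
    rw [← hl, ← hS.add_right (isLift_lift φ) (isLift_lift γ) (isLift_const n), ← hn]
  rw [h1, h2, AddChar.map_add_eq_mul, AddChar.map_add_eq_mul, fourierChar_intCast,
    fourierChar_intCast, mul_one, mul_one]

/-- The 2-cocycle `𝐞 (S f g)` on the loop group, where `f`, `g` are lifts of the loops. -/
def IsAdmissible.toCocycle [DiscreteTopology L] {S : (ℝ → V) → (ℝ → V) → ℝ}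
    (hS : IsAdmissible L S) : CircleCocycle (loopGroup L) where
  toFun φ γ := 𝐞 (S (lift φ) (lift γ))
  cocycle x y z := by
    have hx := isLift_lift x
    have hy := isLift_lift y
    have hz := isLift_lift z
    rw [hS.lift_eq (φ := x + y) (hx.add hy) hz, hS.lift_eq (γ := y + z) hx (hy.add hz),
      hS.add_left hx hy hz, hS.add_right hx hy hz, AddChar.map_add_eq_mul,
      AddChar.map_add_eq_mul]
    simp only [mul_left_comm, mul_comm]

variable [FiniteDimensional ℝ V] [DiscreteTopology L] [IsZLattice ℝ L]

theorem realForm_mem (J : L →ₗ[ℤ] L →ₗ[ℤ] ℤ) {v w : V} (hv : v ∈ L) (hw : w ∈ L) :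
    ∃ k : ℤ, realForm J v w = k :=
  ⟨J ⟨v, hv⟩ ⟨w, hw⟩, realForm_coe J ⟨v, hv⟩ ⟨w, hw⟩⟩

theorem symForm_mem (J : L →ₗ[ℤ] L →ₗ[ℤ] ℤ) {v w : V} (hv : v ∈ L) (hw : w ∈ L) :
    ∃ k : ℤ, symForm J v w = k := by
  obtain ⟨k, hk⟩ := realForm_mem J hv hw
  obtain ⟨l, hl⟩ := realForm_mem J hw hv
  refine ⟨k + l, ?_⟩
  rw [symForm, LinearMap.add_apply, LinearMap.add_apply, LinearMap.flip_apply, hk, hl]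
  push_cast
  rfl

theorem isAdmissible_pairing (J : L →ₗ[ℤ] L →ₗ[ℤ] ℤ) :
    IsAdmissible L (pairing (realForm J)) where
  add_left hf hf' hg := pairing_add_left _ hf.continuous hf'.continuous hg.piecewiseSmooth
  add_right hf hg hg' := pairing_add_right _ hf.continuous hg.piecewiseSmooth hg'.piecewiseSmooth
  const_left hg m := by
    rw [pairing_const_left _ _ hg.continuous hg.piecewiseSmooth]
    exact realForm_mem J m.2 hg.sub_mem
  const_right _ _ := ⟨0, by rw [pairing_const_right, Int.cast_zero]⟩

/-- The loop group cocycle `c(φ, γ) = 𝐞 (∫₀¹ J(f(t), g'(t)) dt)`, with `(f, g)` any lift of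
`(φ, γ)`. -/
def loopCocycle (J : L →ₗ[ℤ] L →ₗ[ℤ] ℤ) : CircleCocycle (loopGroup L) :=
  (isAdmissible_pairing J).toCocycle

theorem loopCocycle_eq (J : L →ₗ[ℤ] L →ₗ[ℤ] ℤ) {φ γ : loopGroup L} {f g : ℝ → V}
    (hf : IsLift L φ.1 f) (hg : IsLift L γ.1 g) :
    (loopCocycle J).toFun φ γ = 𝐞 (∫ t in (0 : ℝ)..1, realForm J (f t) (deriv g t)) :=
  (isAdmissible_pairing J).lift_eq hf hg

/-- The exponent `½ b(Δ_f, Δ_g) + ½ ∫₀¹ ⟨f(t), g'(t)⟩ dt + ½ ⟨f(0), Δ_g⟩` of the Pressley--Segal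
cocycle, where `⟨ , ⟩ = I` and `Δ_f = f(1) - f(0)`. -/
def psExponent (J b : L →ₗ[ℤ] L →ₗ[ℤ] ℤ) (f g : ℝ → V) : ℝ :=
  (1 / 2) * realForm b (f 1 - f 0) (g 1 - g 0) + (1 / 2) * pairing (symForm J) f g +
    (1 / 2) * symForm J (f 0) (g 1 - g 0)

theorem isAdmissible_psExponent (J b : L →ₗ[ℤ] L →ₗ[ℤ] ℤ) :
    IsAdmissible L (psExponent J b) where
  add_left hf hf' hg := by
    simp only [psExponent, pairing_add_left _ hf.continuous hf'.continuous hg.piecewiseSmooth,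
      add_sub_add_comm, map_add, LinearMap.add_apply]
    ring
  add_right hf hg hg' := by
    simp only [psExponent, pairing_add_right _ hf.continuous hg.piecewiseSmooth
      hg'.piecewiseSmooth, add_sub_add_comm, map_add]
    ring
  const_left hg m := by
    obtain ⟨k, hk⟩ := symForm_mem J m.2 hg.sub_mem
    refine ⟨k, ?_⟩
    simp only [psExponent, pairing_const_left _ _ hg.continuous hg.piecewiseSmooth, sub_self,
      map_zero, LinearMap.zero_apply, hk]
    ring
  const_right _ _ := ⟨0, by
    simp only [psExponent, pairing_const_right, sub_self, map_zero, mul_zero, add_zero,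
      Int.cast_zero]⟩

/-- The Pressley--Segal cocycle on the loop group of a torus,
`(-1) ^ b(Δ_f, Δ_g) · 𝐞 (½ ∫₀¹ ⟨f(t), g'(t)⟩ dt + ½ ⟨f(0), Δ_g⟩)`, with `(f, g)` any lift of the
pair of loops, for the form `⟨ , ⟩ = I = J + Jᵗ`. Here `𝐞 (½ k) = (-1) ^ k` for `k : ℤ`. -/
def psCocycle (J b : L →ₗ[ℤ] L →ₗ[ℤ] ℤ) : CircleCocycle (loopGroup L) :=
  (isAdmissible_psExponent J b).toCocycle

theorem psCocycle_eq (J b : L →ₗ[ℤ] L →ₗ[ℤ] ℤ) {φ γ : loopGroup L} {f g : ℝ → V}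
    (hf : IsLift L φ.1 f) (hg : IsLift L γ.1 g) :
    (psCocycle J b).toFun φ γ = 𝐞 (psExponent J b f g) :=
  (isAdmissible_psExponent J b).lift_eq hf hg

/-! ## The line bundle on `T × T`, its connection, and holonomy -/

/-- `(z, x, y) ∼ (z 𝐞(J(m, y)), x + m, y + n)` for `m`, `n` in `L`. -/
def lineSetoid (J : L →ₗ[ℤ] L →ₗ[ℤ] ℤ) : Setoid (ℂ × V × V) where
  r p q := ∃ m n : L, q = (p.1 * 𝐞 (realForm J (m : V) p.2.2), p.2.1 + (m : V), p.2.2 + (n : V))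
  iseqv := by
    have key : ∀ (m n : L) (y : V),
        𝐞 (realForm J (m : V) (y + (n : V))) = 𝐞 (realForm J (m : V) y) := fun m n y => by
      rw [map_add, realForm_coe, AddChar.map_add_eq_mul, fourierChar_intCast, mul_one]
    refine ⟨fun p => ⟨0, 0, by simp⟩, ?_, ?_⟩
    · rintro ⟨z, x, y⟩ _ ⟨m, n, rfl⟩
      refine ⟨-m, -n, ?_⟩
      have h : 𝐞 (realForm J (m : V) y) * 𝐞 (realForm J ((-m : L) : V) (y + (n : V))) = 1 := by
        rw [key, ← AddChar.map_add_eq_mul]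
        simp
      simp only [mul_assoc, ← Circle.coe_mul, h]
      simp
    · rintro ⟨z, x, y⟩ _ _ ⟨m, n, rfl⟩ ⟨m', n', rfl⟩
      refine ⟨m + m', n + n', ?_⟩
      have h : 𝐞 (realForm J (m : V) y) * 𝐞 (realForm J (m' : V) (y + (n : V)))
          = 𝐞 (realForm J ((m + m' : L) : V) y) := by
        rw [key, ← AddChar.map_add_eq_mul]
        simp
      simp only [mul_assoc, ← Circle.coe_mul, h]
      simp [add_assoc]

/-- The total space of the line bundle on `T × T` with multipliers `𝐞(J(m, y))`. -/
def LineBundle (J : L →ₗ[ℤ] L →ₗ[ℤ] ℤ) : Type _ := Quotient (lineSetoid J)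

/-- The point of the line bundle with representative `(z, x, y)`. -/
def LineBundle.mk (J : L →ₗ[ℤ] L →ₗ[ℤ] ℤ) (z : ℂ) (x y : V) : LineBundle J :=
  Quotient.mk (lineSetoid J) (z, x, y)

/-- Fibrewise multiplication by a scalar. -/
def LineBundle.smul (J : L →ₗ[ℤ] L →ₗ[ℤ] ℤ) (w : ℂ) : LineBundle J → LineBundle J :=
  @Quotient.map _ _ (lineSetoid J) (lineSetoid J) (fun p => (w * p.1, p.2)) (by
    rintro ⟨z, x, y⟩ _ ⟨m, n, rfl⟩
    exact ⟨m, n, by simp only [mul_assoc]⟩)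

/-- The connection 1-form `ω_{(x, y)} = - d(J(x, ·))_y` on `V × V`, at `(x, y)` and evaluated at
the tangent vector `(v, w)`. -/
def connectionForm (J : L →ₗ[ℤ] L →ₗ[ℤ] ℤ) (p q : V × V) : ℝ := - realForm J p.1 q.2

/-- The section `t ↦ [z(t), f(t), g(t)]` of the line bundle along the path `(f, g)` is horizontal
for the connection `∇ = d + 2 π i ω`. -/
def IsHorizontal (J : L →ₗ[ℤ] L →ₗ[ℤ] ℤ) (f g : ℝ → V) (z : ℝ → ℂ) : Prop :=
  ContinuousOn z (Icc 0 1) ∧ ∃ P : Finset ℝ, ∀ t ∈ Ioo (0 : ℝ) 1, t ∉ P →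
    HasDerivAt z (-(2 * Real.pi * Complex.I *
      (connectionForm J (f t, g t) (deriv f t, deriv g t) : ℂ) * z t)) t

/-- `w` is the holonomy of the line bundle with connection around the loop `(φ, γ)` in `T × T`:
there are horizontal sections along `(φ, γ)` with any given initial value, and the end point of
each of them is `w` times its starting point. -/
def HasHolonomy (J : L →ₗ[ℤ] L →ₗ[ℤ] ℤ) (φ γ : UnitAddCircle → V ⧸ L) (w : ℂ) : Prop :=
  ∀ f g : ℝ → V, IsLift L φ f → IsLift L γ g →
    (∀ z₀ : ℂ, ∃ z, IsHorizontal J f g z ∧ z 0 = z₀) ∧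
    ∀ z, IsHorizontal J f g z →
      LineBundle.mk J (z 1) (f 1) (g 1) = LineBundle.smul J w (LineBundle.mk J (z 0) (f 0) (g 0))

end Cocycles

end LoopTorus

end

noncomputable section

namespace LoopTorus

/-! ## Integrals depending smoothly on a parameter -/

section Parametric

variable {E : Type*} [NormedAddCommGroup E]

/-! Holonomy. Along a lift `(f, g)` the horizontal equation is `z' = 2πi J(f, g') z`, so `z 1 = 𝐞 (∫
J(f, g')) * z 0` (`IsHorizontal.apply_one`). The fibres over the two ends are identified through the
multiplier `𝐞 (J(Δ_f, g 0))`, which is trivial because `g 0` is a lattice point. Only the second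
loop has to be based.

Comparison of the extensions. It suffices to write the quotient of the two cocycles as the
coboundary of a function `h` that is smooth in families; then `(z, φ) ↦ (z h(φ), φ)` is the
isomorphism (`CircleCocycle.nonempty_extensionIso`). With lifts starting at `0`, integration by
parts gives `∫ J(g, f') + ∫ J(g', f) = J(Δ_g, Δ_f)`. Hence `-½ ∫ J(f, f')` accounts for the integral
part of the quotient and leaves the bilinear sign with exponent `½ (J(Δ_g, Δ_f) + b(Δ_f, Δ_g))`. By
the congruence on `b`, the form `Jᵗ + b` is symmetric modulo 2, so it is congruent modulo 2 to a
symmetric integral form `Q` (`exists_symm_form`). The sign is then cancelled by the quadratic term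
`¼ Q(Δ_f, Δ_f)`, whose polarization is `½ Q(Δ_f, Δ_g)`. This is `comparisonExponent_add`.

Smoothness of `h` (`contDiff_comparison`). In a smooth family of based loops the initial value and
the winding `Δ` of the lifts are continuous with values in a discrete lattice, hence constant. What
varies is `∫ J(f, f')`, which is smooth in the parameter by differentiation under the integral sign
on each piece of the subdivision. -/

theorem continuousOn_slice {W : Type*} [TopologicalSpace W] {G : E × ℝ → W} {a b : ℝ}
    (hG : ContinuousOn G (univ ×ˢ Icc a b)) (u : E) :
    ContinuousOn (fun t => G (u, t)) (Icc a b) :=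
  hG.comp (by fun_prop) fun _ ht => ⟨mem_univ _, ht⟩

theorem continuous_integral_of_continuousOn {W : Type*} [NormedAddCommGroup W] [NormedSpace ℝ W]
    {G : E × ℝ → W} {a b : ℝ} (hab : a < b) (hG : ContinuousOn G (univ ×ˢ Icc a b)) :
    Continuous fun u => ∫ t in a..b, G (u, t) := by
  -- Clamping the time to `[a, b]` gives a continuous function on all of `E × ℝ` without changing
  -- the integral.
  have hc : Continuous fun p : E × ℝ => G (p.1, (projIcc a b hab.le p.2 : ℝ)) :=
    hG.comp_continuous (by fun_prop) fun p => ⟨mem_univ _, (projIcc a b hab.le p.2).2⟩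
  have h := intervalIntegral.continuous_parametric_intervalIntegral_of_continuous'
    (μ := volume) (f := fun u t => G (u, (projIcc a b hab.le t : ℝ))) hc a b
  refine h.congr fun u => intervalIntegral.integral_congr fun t ht => ?_
  rw [uIcc_of_le hab.le] at ht
  simp only [projIcc_of_mem hab.le ht]

variable [NormedSpace ℝ E]

theorem uniqueDiffOn_univ_prod_Icc {a b : ℝ} (hab : a < b) :
    UniqueDiffOn ℝ ((univ : Set E) ×ˢ Icc a b) :=
  uniqueDiffOn_univ.prod (uniqueDiffOn_Icc hab)

/-- Dominated differentiation under the integral sign. The derivative is taken within the closed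
slab, since nothing is known about `G` outside it; in the `E`-directions the slab is everything, so
a genuine derivative in `u` results. -/
theorem hasFDerivAt_integral_of_contDiffOn [FiniteDimensional ℝ E]
    {W : Type*} [NormedAddCommGroup W] [NormedSpace ℝ W] [CompleteSpace W]
    {G : E × ℝ → W} {a b : ℝ} (hab : a < b) (hG : ContDiffOn ℝ 1 G (univ ×ˢ Icc a b)) (u₀ : E) :
    HasFDerivAt (fun u => ∫ t in a..b, G (u, t))
      (∫ t in a..b, (fderivWithin ℝ G (univ ×ˢ Icc a b) (u₀, t)).comp
        (ContinuousLinearMap.inl ℝ E ℝ)) u₀ := by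
  have hs := uniqueDiffOn_univ_prod_Icc (E := E) hab
  have hD : ContinuousOn (fun p : E × ℝ => (fderivWithin ℝ G (univ ×ˢ Icc a b) p).comp
      (ContinuousLinearMap.inl ℝ E ℝ)) (univ ×ˢ Icc a b) :=
    (hG.continuousOn_fderivWithin hs le_rfl).clm_comp continuousOn_const
  -- A constant dominates because closed balls in the finite-dimensional space `E` are compact.
  obtain ⟨C, hC⟩ := ((isCompact_closedBall u₀ 1).prod (isCompact_Icc (a := a) (b := b)))
    |>.exists_bound_of_continuousOn (hD.mono (prod_mono_left (subset_univ _)))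
  have hsub : uIoc a b ⊆ Icc a b := by
    rw [uIoc_of_le hab.le]
    exact Ioc_subset_Icc_self
  refine intervalIntegral.hasFDerivAt_integral_of_dominated_of_fderiv_le (bound := fun _ => C)
    (F := fun u t => G (u, t))
    (F' := fun u t => (fderivWithin ℝ G (univ ×ˢ Icc a b) (u, t)).comp
        (ContinuousLinearMap.inl ℝ E ℝ))
    (Metric.closedBall_mem_nhds u₀ one_pos)
    (Eventually.of_forall fun u => ?_) ?_ ?_
    (Eventually.of_forall fun t ht u hu => hC (u, t) ⟨hu, hsub ht⟩) (by simp)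
    (Eventually.of_forall fun t ht u _ => ?_)
  · exact ((continuousOn_slice hG.continuousOn u).mono hsub).aestronglyMeasurable
      measurableSet_uIoc
  · refine ContinuousOn.intervalIntegrable ?_
    rw [uIcc_of_le hab.le]
    exact continuousOn_slice hG.continuousOn u₀
  · exact ((continuousOn_slice hD u₀).mono hsub).aestronglyMeasurable measurableSet_uIoc
  · have h1 := ((hG.differentiableOn (by simp)) (u, t) ⟨mem_univ _, hsub ht⟩).hasFDerivWithinAt
    have h2 : HasFDerivAt (fun v : E => (v, t)) (ContinuousLinearMap.inl ℝ E ℝ) u :=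
      hasFDerivAt_prodMk_left u t
    have h3 := h1.comp (s := univ) (t := univ ×ˢ Icc a b) u h2.hasFDerivWithinAt
      (fun v _ => ⟨mem_univ _, hsub ht⟩)
    exact hasFDerivWithinAt_univ.1 h3

/-- Induction on the order of smoothness: the derivative of the integral is again an integral of the
same kind, with values in `E →L[ℝ] W`. Taking `E : Type` keeps this space in the universe of `W`, so
that the induction hypothesis applies to it. -/
theorem contDiff_integral_of_contDiffOn_nat {E : Type} {W : Type*}
    [NormedAddCommGroup E] [NormedSpace ℝ E] [FiniteDimensional ℝ E]
    [NormedAddCommGroup W] [NormedSpace ℝ W] [CompleteSpace W]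
    {a b : ℝ} (hab : a < b) (n : ℕ) {G : E × ℝ → W} (hG : ContDiffOn ℝ n G (univ ×ˢ Icc a b)) :
    ContDiff ℝ n fun u => ∫ t in a..b, G (u, t) := by
  induction n generalizing W with
  | zero => exact contDiff_zero.2 (continuous_integral_of_continuousOn hab hG.continuousOn)
  | succ n ih =>
    have hG1 : ContDiffOn ℝ 1 G (univ ×ˢ Icc a b) := hG.of_le (by norm_cast; omega)
    refine contDiff_succ_iff_hasFDerivAt.2 ⟨fun u₀ =>
      ∫ t in a..b, (fderivWithin ℝ G (univ ×ˢ Icc a b) (u₀, t)).comp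
        (ContinuousLinearMap.inl ℝ E ℝ),
      ih (G := fun p => (fderivWithin ℝ G (univ ×ˢ Icc a b) p).comp
        (ContinuousLinearMap.inl ℝ E ℝ)) ?_, hasFDerivAt_integral_of_contDiffOn hab hG1⟩
    exact (hG.fderivWithin (uniqueDiffOn_univ_prod_Icc hab) (by norm_cast)).clm_comp
      contDiffOn_const

theorem contDiff_integral_of_contDiffOn {E : Type} {W : Type*}
    [NormedAddCommGroup E] [NormedSpace ℝ E] [FiniteDimensional ℝ E]
    [NormedAddCommGroup W] [NormedSpace ℝ W] [CompleteSpace W]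
    {a b : ℝ} (hab : a < b) {G : E × ℝ → W} (hG : ContDiffOn ℝ ∞ G (univ ×ˢ Icc a b)) :
    ContDiff ℝ ∞ fun u => ∫ t in a..b, G (u, t) :=
  contDiff_infty.2 fun n =>
    contDiff_integral_of_contDiffOn_nat hab n (hG.of_le (by exact_mod_cast le_top))

end Parametric

/-! ## Integrals along piecewise smooth paths -/

section Paths

/-- A relation between the ends of subintervals of `[0, 1]` holds for `[0, 1]` if it is reflexive
and transitive and holds for intervals without interior points in a given finite set. -/
theorem interval_induction (P : Finset ℝ) {R : ℝ → ℝ → Prop} (refl : ∀ a, R a a)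
    (trans : ∀ a b c, 0 ≤ a → a < b → b < c → c ≤ 1 → R a b → R b c → R a c)
    (base : ∀ a b, 0 ≤ a → a < b → b ≤ 1 → (∀ p ∈ P, p ∉ Ioo a b) → R a b) : R 0 1 := by
  classical
  -- Induction on the number of points of `P` in the open interval: cutting at such a point leaves
  -- fewer of them inside each half.
  have key : ∀ (k : ℕ) (a b : ℝ), 0 ≤ a → a ≤ b → b ≤ 1 →
      (P.filter (fun p => p ∈ Ioo a b)).card = k → R a b := by
    intro k
    induction k using Nat.strong_induction_on with
    | _ k ih =>
      intro a b h0 hab h1 hk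
      rcases hab.eq_or_lt with rfl | hlt
      · exact refl a
      by_cases hne : ∃ p ∈ P, p ∈ Ioo a b
      · obtain ⟨p, hp, hpI⟩ := hne
        have hcard : ∀ a' b', a ≤ a' → b' ≤ b → p ∉ Ioo a' b' →
            (P.filter (fun q => q ∈ Ioo a' b')).card < k := by
          intro a' b' ha hb hpn
          rw [← hk]
          refine Finset.card_lt_card (Finset.ssubset_iff_of_subset ?_ |>.2 ⟨p, ?_, ?_⟩)
          · intro q hq
            rw [Finset.mem_filter] at hq ⊢
            exact ⟨hq.1, lt_of_le_of_lt ha hq.2.1, lt_of_lt_of_le hq.2.2 hb⟩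
          · exact Finset.mem_filter.2 ⟨hp, hpI⟩
          · exact fun h => hpn (Finset.mem_filter.1 h).2
        exact trans a p b h0 hpI.1 hpI.2 h1
          (ih _ (hcard a p le_rfl hpI.2.le fun h => lt_irrefl _ h.2) a p h0 hpI.1.le
            (hpI.2.le.trans h1) rfl)
          (ih _ (hcard p b hpI.1.le le_rfl fun h => lt_irrefl _ h.1) p b (h0.trans hpI.1.le)
            hpI.2.le h1 rfl)
      · push Not at hne
        exact base a b h0 hlt h1 hne
  exact key _ 0 1 le_rfl zero_le_one le_rfl rfl

variable {V : Type*} [NormedAddCommGroup V] [NormedSpace ℝ V]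

/-- Away from the subdivision points, `t` is interior to a small closed interval that avoids them.
Beyond differentiability, this yields continuity of `deriv g` at `t`, needed for the fundamental
theorem of calculus. -/
theorem PiecewiseSmooth.exists_contDiffAt {g : ℝ → V} (hg : PiecewiseSmooth g) :
    ∃ P : Finset ℝ, ∀ t ∈ Ioo (0 : ℝ) 1, t ∉ P → ContDiffAt ℝ ∞ g t := by
  obtain ⟨P, hP⟩ := hg
  refine ⟨P, fun t ht htP => ?_⟩
  have ho : IsOpen (Ioo (0 : ℝ) 1 ∩ (P : Set ℝ)ᶜ) :=
    isOpen_Ioo.inter P.finite_toSet.isClosed.isOpen_compl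
  obtain ⟨ε, hε, hb⟩ := Metric.isOpen_iff.1 ho t ⟨ht, htP⟩
  have hsub : ∀ s ∈ Icc (t - ε / 2) (t + ε / 2), s ∈ Ioo (0 : ℝ) 1 ∩ (P : Set ℝ)ᶜ := fun s hs => by
    refine hb ?_
    rw [Metric.mem_ball, Real.dist_eq, abs_lt]
    constructor <;> linarith [hs.1, hs.2]
  have h1 := hsub (t - ε / 2) ⟨le_rfl, by linarith⟩
  have h2 := hsub (t + ε / 2) ⟨by linarith, le_rfl⟩
  exact (hP (t - ε / 2) (t + ε / 2) h1.1.1.le (by linarith) h2.1.2.le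
    (fun p hp hpI => (hsub p ⟨hpI.1.le, hpI.2.le⟩).2 hp)).contDiffAt
    (Icc_mem_nhds (by linarith) (by linarith))

variable [FiniteDimensional ℝ V]

theorem hasDerivAt_bilin (K : V →ₗ[ℝ] V →ₗ[ℝ] ℝ) {f g : ℝ → V} {f' g' : V} {t : ℝ}
    (hf : HasDerivAt f f' t) (hg : HasDerivAt g g' t) :
    HasDerivAt (fun s => K (f s) (g s)) (K (f t) g' + K f' (g t)) t := by
  have h := (K.toContinuousBilinearMap).hasFDerivAt_of_bilinear hf.hasFDerivAt hg.hasFDerivAt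
    |>.hasDerivAt
  simpa using h

theorem continuous_bilin (K : V →ₗ[ℝ] V →ₗ[ℝ] ℝ) {X : Type*} [TopologicalSpace X] {f g : X → V}
    (hf : Continuous f) (hg : Continuous g) : Continuous fun t => K (f t) (g t) :=
  (K.toContinuousBilinearMap.continuous.comp hf).clm_apply hg

/-- Integration by parts. -/
theorem pairing_add_pairing_flip (K : V →ₗ[ℝ] V →ₗ[ℝ] ℝ) {f g : ℝ → V} (hf : Continuous f)
    (hf' : PiecewiseSmooth f) (hg : Continuous g) (hg' : PiecewiseSmooth g) :
    pairing K f g + pairing K.flip g f = K (f 1) (g 1) - K (f 0) (g 0) := by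
  classical
  obtain ⟨P, hP⟩ := hf'.exists_differentiableAt
  obtain ⟨Q, hQ⟩ := hg'.exists_differentiableAt
  have i1 := intervalIntegrable_form K hf hg'
  have i2 := intervalIntegrable_form K.flip hg hf'
  unfold pairing
  rw [← intervalIntegral.integral_add i1 i2]
  refine integral_eq_of_hasDerivAt_off_countable_of_le (fun t => K (f t) (g t)) _ zero_le_one
    (P ∪ Q).countable_toSet (continuous_bilin K hf hg).continuousOn (fun t ht => ?_) (i1.add i2)
  simp only [Finset.coe_union, Set.mem_sdiff, mem_union, Finset.mem_coe, not_or] at ht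
  exact hasDerivAt_bilin K (hP t ht.1 ht.2.1).hasDerivAt (hQ t ht.1 ht.2.2).hasDerivAt

theorem pairing_form_add (K K' : V →ₗ[ℝ] V →ₗ[ℝ] ℝ) {f g : ℝ → V} (hf : Continuous f)
    (hg : PiecewiseSmooth g) : pairing (K + K') f g = pairing K f g + pairing K' f g := by
  unfold pairing
  rw [← intervalIntegral.integral_add (intervalIntegrable_form K hf hg)
    (intervalIntegrable_form K' hf hg)]
  rfl

end Paths

/-! ## Bilinear forms modulo 2 -/

section Symmetrize

variable {M : Type*} [AddCommGroup M] {ι : Type*}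

/-- The integer-valued bilinear form with given values on a basis. -/
def formOfBasis (e : Module.Basis ι ℤ M) (c : ι → ι → ℤ) : M →ₗ[ℤ] M →ₗ[ℤ] ℤ :=
  e.constr ℤ fun i => e.constr ℤ (c i)

theorem formOfBasis_basis (e : Module.Basis ι ℤ M) (c : ι → ι → ℤ) (i j : ι) :
    formOfBasis e c (e i) (e j) = c i j := by
  rw [formOfBasis, Module.Basis.constr_basis, Module.Basis.constr_basis]

/-- On a free abelian group, an integer-valued bilinear form that is symmetric modulo 2 is
congruent modulo 2 to a symmetric form. -/
theorem exists_symm_form (e : Module.Basis ι ℤ M) (β : M →ₗ[ℤ] M →ₗ[ℤ] ℤ)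
    (hβ : ∀ m n, β m n ≡ β n m [ZMOD 2]) :
    ∃ Q D : M →ₗ[ℤ] M →ₗ[ℤ] ℤ, (∀ m n, Q m n = Q n m) ∧ ∀ m n, β m n = Q m n + 2 * D m n := by
  classical
  -- Any linear order on the index set will do: `Q` copies the entries of `β` with `i ≤ j` and
  -- reflects them across the diagonal, which changes the remaining entries by even numbers.
  obtain ⟨_, -⟩ := exists_wellFoundedLT ι
  have hd : ∀ i j, ∃ d : ℤ,
      β (e i) (e j) = (if i ≤ j then β (e i) (e j) else β (e j) (e i)) + 2 * d := fun i j => by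
    split_ifs with h
    · exact ⟨0, by ring⟩
    · obtain ⟨d, hd⟩ := (hβ (e j) (e i)).dvd
      exact ⟨d, by linarith⟩
  choose d hd using hd
  refine ⟨formOfBasis e fun i j => if i ≤ j then β (e i) (e j) else β (e j) (e i),
    formOfBasis e d, ?_, ?_⟩
  · have : (formOfBasis e fun i j => if i ≤ j then β (e i) (e j) else β (e j) (e i)) =
        (formOfBasis e fun i j => if i ≤ j then β (e i) (e j) else β (e j) (e i)).flip := by
      refine LinearMap.ext_basis e e fun i j => ?_
      rw [LinearMap.flip_apply, formOfBasis_basis, formOfBasis_basis]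
      rcases lt_trichotomy i j with h | rfl | h
      · rw [if_pos h.le, if_neg h.not_ge]
      · rfl
      · rw [if_neg h.not_ge, if_pos h.le]
    exact fun m n => LinearMap.congr_fun₂ this m n
  · have : β = (formOfBasis e fun i j => if i ≤ j then β (e i) (e j) else β (e j) (e i)) +
        (2 : ℤ) • formOfBasis e d := by
      refine LinearMap.ext_basis e e fun i j => ?_
      simp only [LinearMap.add_apply, LinearMap.smul_apply, formOfBasis_basis, smul_eq_mul]
      exact hd i j
    intro m n
    conv_lhs => rw [this]
    simp

end Symmetrize

/-! ## Isomorphisms of extensions from coboundaries -/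

section Coboundary

namespace CircleCocycle

variable {A : Type*} [AddCommGroup A]

/-- A function `h` whose coboundary is the quotient of two cocycles gives an isomorphism of the
central extensions. -/
theorem nonempty_extensionIso (c c' : CircleCocycle A)
    (S : ∀ n : ℕ, (EuclideanSpace ℝ (Fin n) → A) → Prop) (h : A → Circle)
    (hh : ∀ x y, h x * h y * c'.toFun x y = c.toFun x y * h (x + y))
    (hS : ∀ n p, S n p → ContDiff ℝ ∞ fun u => (h (p u) : ℂ)) :
    Nonempty (ExtensionIso c c' S) := by
  -- The cocycles are not assumed normalized, so the inclusions of `U(1)` involve `c(0, 0)` and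
  -- `c'(0, 0)`; this relation makes the map respect them.
  have h0 : c'.toFun 0 0 * h 0 = c.toFun 0 0 := by
    have h00 := hh 0 0
    rw [add_zero, mul_assoc, mul_comm (c.toFun 0 0)] at h00
    rw [mul_comm]
    exact mul_left_cancel h00
  refine ⟨⟨⟨⟨fun x => ⟨x.coord * h x.base, x.base⟩, fun x => ⟨x.coord * (h x.base)⁻¹, x.base⟩,
    fun x => ?_, fun x => ?_⟩, fun x y => ?_⟩, fun z => ?_, fun x => rfl, fun n e he hb => ?_,
    fun n e he hb => ?_⟩⟩
  · simp
  · simp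
  · apply Extension.ext
    · simp only [Extension.mul_coord, Extension.mul_base]
      calc x.coord * y.coord * c.toFun x.base y.base * h (x.base + y.base)
          = x.coord * y.coord * (c.toFun x.base y.base * h (x.base + y.base)) := by
            rw [mul_assoc]
        _ = _ := by
            rw [← hh]
            simp only [mul_assoc, mul_left_comm]
    · rfl
  · apply Extension.ext
    · change z * (c.toFun 0 0)⁻¹ * h 0 = z * (c'.toFun 0 0)⁻¹
      rw [← h0, mul_inv_rev, mul_assoc, mul_right_comm, inv_mul_cancel, one_mul]
    · rfl
  · refine ⟨?_, hb⟩
    change ContDiff ℝ ∞ fun u => (((e u).coord * h (e u).base : Circle) : ℂ)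
    simp only [Circle.coe_mul]
    exact he.mul (hS n _ hb)
  · refine ⟨?_, hb⟩
    change ContDiff ℝ ∞ fun u => (((e u).coord * (h (e u).base)⁻¹ : Circle) : ℂ)
    simp only [Circle.coe_mul, Circle.coe_inv_eq_conj]
    -- On the circle inversion is conjugation, which is real linear and hence smooth.
    exact he.mul (Complex.conjCLE.contDiff.comp (hS n _ hb))

end CircleCocycle

end Coboundary

/-! ## The holonomy -/

section Holonomy

variable {V : Type*} [NormedAddCommGroup V] [NormedSpace ℝ V] {L : Submodule ℤ V}

theorem IsLift.apply_zero_mem {γ : loopGroup L} (hγ : γ ∈ basedLoops L) {f : ℝ → V}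
    (hf : IsLift L γ.1 f) : f 0 ∈ L := by
  have h0 : γ.1 0 = 0 := hγ
  rw [← Submodule.Quotient.mk_eq_zero L, hf.lifts 0, QuotientAddGroup.mk_zero, h0]

/-- The primitive `t ↦ ∫₀ᵗ K(f(s), g'(s)) ds`. -/
def pairingPrimitive (K : V →ₗ[ℝ] V →ₗ[ℝ] ℝ) (f g : ℝ → V) (t : ℝ) : ℝ :=
  ∫ s in (0 : ℝ)..t, K (f s) (deriv g s)

theorem hasDerivAt_cexp_pairingPrimitive {K : V →ₗ[ℝ] V →ₗ[ℝ] ℝ} {f g : ℝ → V} {t : ℝ}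
    (h : HasDerivAt (pairingPrimitive K f g) (K (f t) (deriv g t)) t) (a : ℂ) :
    HasDerivAt (fun s => Complex.exp (a * pairingPrimitive K f g s))
      (Complex.exp (a * pairingPrimitive K f g t) * (a * K (f t) (deriv g t))) t :=
  (h.ofReal_comp.const_mul a).cexp

variable [FiniteDimensional ℝ V]

theorem continuousOn_pairingPrimitive (K : V →ₗ[ℝ] V →ₗ[ℝ] ℝ) {f g : ℝ → V} (hf : Continuous f)
    (hg : PiecewiseSmooth g) : ContinuousOn (pairingPrimitive K f g) (Icc 0 1) := by
  have h := intervalIntegral.continuousOn_primitive_interval'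
    (intervalIntegrable_form K hf hg) left_mem_uIcc
  rwa [uIcc_of_le zero_le_one] at h

theorem hasDerivAt_pairingPrimitive (K : V →ₗ[ℝ] V →ₗ[ℝ] ℝ) {f g : ℝ → V} (hf : Continuous f)
    (hg : PiecewiseSmooth g) : ∃ P : Finset ℝ, ∀ t ∈ Ioo (0 : ℝ) 1, t ∉ P →
      HasDerivAt (pairingPrimitive K f g) (K (f t) (deriv g t)) t := by
  obtain ⟨P, hP⟩ := hg.exists_contDiffAt
  have hi := intervalIntegrable_form K hf hg
  refine ⟨P, fun t ht htP => intervalIntegral.integral_hasDerivAt_right ?_ ?_ ?_⟩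
  · refine hi.mono_set ?_
    rw [uIcc_of_le zero_le_one, uIcc_of_le ht.1.le]
    exact Icc_subset_Icc_right ht.2.le
  · refine ⟨Ioc 0 1, Ioc_mem_nhds ht.1 ht.2, ?_⟩
    rw [intervalIntegrable_iff_integrableOn_Ioc_of_le zero_le_one] at hi
    exact hi.aestronglyMeasurable
  · have hd : ContinuousAt (deriv g) t := by
      have := (hP t ht htP).fderiv_right (m := 0) (by simp)
      exact this.continuousAt.clm_apply continuousAt_const
    exact (K.toContinuousBilinearMap.continuous.continuousAt.comp hf.continuousAt).clm_apply hd

variable [DiscreteTopology L] [IsZLattice ℝ L]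

/-- Multiplying `z` by the integrating factor `exp(-2πi ∫₀ᵗ J(f, g'))` gives a continuous function
whose derivative vanishes off a finite set, so its values at `0` and `1` agree. -/
theorem IsHorizontal.apply_one {J : L →ₗ[ℤ] L →ₗ[ℤ] ℤ} {f g : ℝ → V} {z : ℝ → ℂ}
    (hz : IsHorizontal J f g z) (hf : Continuous f) (hg : PiecewiseSmooth g) :
    z 1 = 𝐞 (pairing (realForm J) f g) * z 0 := by
  classical
  obtain ⟨hc, P, hP⟩ := hz
  obtain ⟨Q, hQ⟩ := hasDerivAt_pairingPrimitive (realForm J) hf hg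
  set a : ℂ := -(2 * Real.pi * Complex.I) with ha
  have hΦ := continuousOn_pairingPrimitive (realForm J) hf hg
  have h := integral_eq_of_hasDerivAt_off_countable_of_le
    (fun t => z t * Complex.exp (a * pairingPrimitive (realForm J) f g t)) (fun _ => 0)
    zero_le_one (P ∪ Q).countable_toSet
    (hc.mul ((Complex.continuous_ofReal.comp_continuousOn hΦ).const_mul a |>.cexp))
    (fun t ht => ?_) (by simp)
  · have h1 : pairingPrimitive (realForm J) f g 1 = pairing (realForm J) f g := rfl
    have h2 : pairingPrimitive (realForm J) f g 0 = 0 := intervalIntegral.integral_same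
    rw [intervalIntegral.integral_zero, h1, h2, Complex.ofReal_zero, mul_zero, Complex.exp_zero,
      mul_one, eq_comm, sub_eq_zero] at h
    rw [← h, Real.fourierChar_apply, mul_left_comm, ← Complex.exp_add]
    have : 2 * Real.pi * pairing (realForm J) f g * Complex.I +
        a * pairing (realForm J) f g = 0 := by
      rw [ha]
      ring
    push_cast
    rw [this, Complex.exp_zero, mul_one]
  · simp only [Finset.coe_union, Set.mem_sdiff, mem_union, Finset.mem_coe, not_or] at ht
    refine ((hP t ht.1 ht.2.1).mul
      (hasDerivAt_cexp_pairingPrimitive (hQ t ht.1 ht.2.2) a)).congr_deriv ?_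
    simp only [connectionForm, ha]
    push_cast
    ring

theorem exists_isHorizontal (J : L →ₗ[ℤ] L →ₗ[ℤ] ℤ) {f g : ℝ → V} (hf : Continuous f)
    (hg : PiecewiseSmooth g) (z₀ : ℂ) : ∃ z, IsHorizontal J f g z ∧ z 0 = z₀ := by
  obtain ⟨Q, hQ⟩ := hasDerivAt_pairingPrimitive (realForm J) hf hg
  have hΦ := continuousOn_pairingPrimitive (realForm J) hf hg
  refine ⟨fun t => z₀ * Complex.exp (2 * Real.pi * Complex.I *
    pairingPrimitive (realForm J) f g t), ⟨?_, Q, fun t ht htQ => ?_⟩, ?_⟩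
  · exact continuousOn_const.mul
      ((Complex.continuous_ofReal.comp_continuousOn hΦ).const_mul _ |>.cexp)
  · refine ((hasDerivAt_cexp_pairingPrimitive (hQ t ht htQ) _).const_mul z₀).congr_deriv ?_
    simp only [connectionForm]
    push_cast
    ring
  · have h2 : pairingPrimitive (realForm J) f g 0 = 0 := intervalIntegral.integral_same
    simp [h2]

theorem hasHolonomy_loopCocycle (J : L →ₗ[ℤ] L →ₗ[ℤ] ℤ) {φ γ : loopGroup L}
    (hγ : γ ∈ basedLoops L) : HasHolonomy J φ.1 γ.1 ((loopCocycle J).toFun φ γ) := by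
  intro f g hf hg
  refine ⟨exists_isHorizontal J hf.continuous hg.piecewiseSmooth, fun z hz => ?_⟩
  rw [loopCocycle_eq J hf hg, hz.apply_one hf.continuous hg.piecewiseSmooth]
  -- The deck translation by `(Δ_f, Δ_g)` carries the starting fibre to the final one; its
  -- multiplier `𝐞 (J(Δ_f, g 0))` is `1` because `g 0` lies in `L`.
  refine (Quotient.sound (s := lineSetoid J) ⟨⟨_, hf.sub_mem⟩, ⟨_, hg.sub_mem⟩, ?_⟩).symm
  obtain ⟨k, hk⟩ := realForm_mem J hf.sub_mem (hg.apply_zero_mem hγ)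
  simp only [hk, fourierChar_intCast, Circle.coe_one, mul_one, add_sub_cancel]
  rfl

end Holonomy

/-! ## The comparison of the two cocycles -/

section Comparison

theorem eq_of_continuous_of_mem {V : Type*} [NormedAddCommGroup V] {L : Submodule ℤ V}
    [DiscreteTopology L] {X : Type*} [TopologicalSpace X] [PreconnectedSpace X] {d : X → V}
    (hd : Continuous d) (hmem : ∀ x, d x ∈ L) (x y : X) :
    d x = d y :=
  congrArg Subtype.val (PreconnectedSpace.constant (f := fun x => (⟨d x, hmem x⟩ : L))
    inferInstance (hd.subtype_mk hmem) (x := x) (y := y))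

variable {V : Type*} [NormedAddCommGroup V] [NormedSpace ℝ V]

theorem contDiffOn_bilin [FiniteDimensional ℝ V] (K : V →ₗ[ℝ] V →ₗ[ℝ] ℝ) {X : Type*}
    [NormedAddCommGroup X] [NormedSpace ℝ X] {s : Set X} {f g : X → V} (hf : ContDiffOn ℝ ∞ f s)
    (hg : ContDiffOn ℝ ∞ g s) : ContDiffOn ℝ ∞ (fun x => K (f x) (g x)) s :=
  (K.toContinuousBilinearMap.contDiff.comp_contDiffOn hf).clm_apply hg

theorem contDiffOn_slice {E : Type*} [NormedAddCommGroup E] [NormedSpace ℝ E] {H : E × ℝ → V}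
    {a b : ℝ} (hH : ContDiffOn ℝ ∞ H (univ ×ˢ Icc a b)) (u : E) :
    ContDiffOn ℝ ∞ (fun t => H (u, t)) (Icc a b) :=
  hH.comp (by fun_prop) fun _ ht => ⟨mem_univ _, ht⟩

/-- Replaces the time derivative by an expression that is jointly smooth up to the ends of the
interval. At the ends themselves the two may differ, which the integral does not see. -/
theorem deriv_slice {E : Type*} [NormedAddCommGroup E] [NormedSpace ℝ E] {H : E × ℝ → V}
    {a b : ℝ} (hH : ContDiffOn ℝ ∞ H (univ ×ˢ Icc a b)) (u : E) {t : ℝ} (ht : t ∈ Ioo a b) :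
    deriv (fun t => H (u, t)) t = fderivWithin ℝ H (univ ×ˢ Icc a b) (u, t) (0, 1) := by
  have h1 := (hH.differentiableOn (by simp) (u, t)
    ⟨mem_univ _, Ioo_subset_Icc_self ht⟩).hasFDerivWithinAt
  have h2 : HasDerivAt (fun s : ℝ => (u, s)) ((0 : E), (1 : ℝ)) t :=
    (hasDerivAt_const t u).prodMk (hasDerivAt_id t)
  have h3 := h1.comp_hasDerivWithinAt (s := Icc a b) (t := univ ×ˢ Icc a b) t
    h2.hasDerivWithinAt fun s hs => ⟨mem_univ _, hs⟩
  exact (h3.hasDerivAt (Icc_mem_nhds ht.1 ht.2)).deriv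

/-- The pairing of a smooth family of paths with itself depends smoothly on the parameter. -/
theorem contDiff_pairing [FiniteDimensional ℝ V] (K : V →ₗ[ℝ] V →ₗ[ℝ] ℝ) {E : Type}
    [NormedAddCommGroup E] [NormedSpace ℝ E] [FiniteDimensional ℝ E] {H : E × ℝ → V}
    (P : Finset ℝ) (hP : ∀ a b : ℝ, 0 ≤ a → a < b → b ≤ 1 → (∀ q ∈ P, q ∉ Ioo a b) →
      ContDiffOn ℝ ∞ H (univ ×ˢ Icc a b)) :
    ContDiff ℝ ∞ fun u => pairing K (fun t => H (u, t)) (fun t => H (u, t)) := by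
  let G : E → ℝ → ℝ := fun u t => K (H (u, t)) (deriv (fun t => H (u, t)) t)
  suffices h : (∀ u, IntervalIntegrable (G u) volume 0 1) ∧
      ContDiff ℝ ∞ fun u => ∫ t in (0 : ℝ)..1, G u t from h.2
  -- Integrability is carried along because additivity of the integral over adjacent intervals
  -- requires it.
  refine interval_induction P (R := fun a b => (∀ u, IntervalIntegrable (G u) volume a b) ∧
      ContDiff ℝ ∞ fun u => ∫ t in a..b, G u t) (fun a => ?_) (fun a b c _ _ _ _ hab hbc => ?_)
      (fun a b h0 hab h1 hq => ?_)
  · simp only [intervalIntegral.integral_same]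
    exact ⟨fun _ => IntervalIntegrable.refl, contDiff_const⟩
  · refine ⟨fun u => (hab.1 u).trans (hbc.1 u), ?_⟩
    simp only [fun u => (intervalIntegral.integral_add_adjacent_intervals
      (hab.1 u) (hbc.1 u)).symm]
    exact hab.2.add hbc.2
  · have hH := hP a b h0 hab h1 hq
    have hd : ContDiffOn ℝ ∞ (fun p => K (H p) (fderivWithin ℝ H (univ ×ˢ Icc a b) p (0, 1)))
        (univ ×ˢ Icc a b) :=
      contDiffOn_bilin K hH
        ((hH.fderivWithin (uniqueDiffOn_univ_prod_Icc hab) (by simp)).clm_apply contDiffOn_const)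
    have heq : ∀ u, EqOn (fun t => K (H (u, t))
        (fderivWithin ℝ H (univ ×ˢ Icc a b) (u, t) (0, 1))) (G u) (uIoo a b) := fun u t ht => by
      rw [uIoo_of_le hab.le] at ht
      simp only [G, deriv_slice hH u ht]
    refine ⟨fun u => ?_, ?_⟩
    · have hc := continuousOn_slice hd.continuousOn u
      exact (hc.intervalIntegrable_of_Icc hab.le).congr_uIoo (heq u)
    · convert contDiff_integral_of_contDiffOn hab hd using 2 with u
      exact (intervalIntegral.integral_congr_uIoo (heq u)).symm

variable {L : Submodule ℤ V}

theorem IsSmoothFamily'.isSmoothFamily {A : AddSubgroup (loopGroup L)} {n : ℕ}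
    {p : EuclideanSpace ℝ (Fin n) → A} (hp : IsSmoothFamily' L A n p) :
    IsSmoothFamily L A n p := by
  obtain ⟨F, hF, hl⟩ := hp
  exact ⟨F, hF.continuous, hl, ∅, fun _ _ _ _ _ _ => hF.contDiffOn⟩

theorem smoothBasedLoops_le : smoothBasedLoops L ≤ basedLoops L := fun _ h => h.1

/-- The lift of a based loop with initial value `0`. -/
def basedLift (φ : loopGroup L) (t : ℝ) : V := lift φ t - lift φ 0

/-- Two lifts differ by a constant, so the chosen lift may be replaced by any other one, in
particular by a sum of lifts or a member of a smooth family. -/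
theorem IsLift.basedLift_eq [DiscreteTopology L] {φ : loopGroup L} {f : ℝ → V}
    (hf : IsLift L φ.1 f) : basedLift φ = fun t => f t - f 0 := by
  obtain ⟨m, hm⟩ := (isLift_lift φ).eq_add hf
  funext t
  rw [hm, basedLift, add_sub_add_right_eq_sub]

theorem isLift_basedLift {φ : loopGroup L} (hφ : φ ∈ basedLoops L) :
    IsLift L φ.1 (basedLift φ) := by
  have h := (isLift_lift φ).add
    (isLift_const (-⟨lift φ 0, (isLift_lift φ).apply_zero_mem hφ⟩ : L))
  simp only [ZeroMemClass.coe_zero, add_zero, NegMemClass.coe_neg, ← sub_eq_add_neg] at h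
  exact h

theorem basedLift_zero (φ : loopGroup L) : basedLift φ 0 = 0 := sub_self _

variable [FiniteDimensional ℝ V] [DiscreteTopology L] [IsZLattice ℝ L]

/-- The exponent `¼ Q(Δ_f, Δ_f) - ½ ∫₀¹ J(f(t), f'(t)) dt` of the function on based loops that
relates the two cocycles. -/
def comparisonExponent (J Q : L →ₗ[ℤ] L →ₗ[ℤ] ℤ) (f : ℝ → V) : ℝ :=
  (1 / 4) * realForm Q (f 1 - f 0) (f 1 - f 0) - (1 / 2) * pairing (realForm J) f f

theorem comparisonExponent_add {J b Q D : L →ₗ[ℤ] L →ₗ[ℤ] ℤ} (hQ : ∀ m n, Q m n = Q n m)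
    (hD : ∀ m n, J n m + b m n = Q m n + 2 * D m n) {φ γ : loopGroup L} {f g : ℝ → V}
    (hf : IsLift L φ.1 f) (hg : IsLift L γ.1 g) (hf0 : f 0 = 0) (hg0 : g 0 = 0) :
    ∃ k : ℤ, comparisonExponent J Q f + comparisonExponent J Q g + psExponent J b f g =
      pairing (realForm J) f g + comparisonExponent J Q (fun t => f t + g t) + k := by
  have hm : f 1 ∈ L := by simpa [hf0] using hf.sub_mem
  have hn : g 1 ∈ L := by simpa [hg0] using hg.sub_mem
  -- After integration by parts the two sides differ by `½ (J(Δ_g, Δ_f) + b(Δ_f, Δ_g) - Q(Δ_f,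
  -- Δ_g))`, which is this value of `D`.
  refine ⟨D ⟨f 1, hm⟩ ⟨g 1, hn⟩, ?_⟩
  have hfg := hf.add hg
  have e1 := realForm_coe J ⟨g 1, hn⟩ ⟨f 1, hm⟩
  have e2 := realForm_coe b ⟨f 1, hm⟩ ⟨g 1, hn⟩
  have e3 := realForm_coe Q ⟨f 1, hm⟩ ⟨g 1, hn⟩
  have e4 := realForm_coe Q ⟨g 1, hn⟩ ⟨f 1, hm⟩
  -- Symmetry of `Q` merges the two cross terms of `¼ Q(Δ, Δ)` into `½ Q(Δ_f, Δ_g)`.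
  rw [hQ] at e4
  have hD' : (J ⟨g 1, hn⟩ ⟨f 1, hm⟩ + b ⟨f 1, hm⟩ ⟨g 1, hn⟩ : ℝ) =
      Q ⟨f 1, hm⟩ ⟨g 1, hn⟩ + 2 * D ⟨f 1, hm⟩ ⟨g 1, hn⟩ := by
    exact_mod_cast hD ⟨f 1, hm⟩ ⟨g 1, hn⟩
  have hp := pairing_add_pairing_flip (realForm J) hg.continuous hg.piecewiseSmooth
    hf.continuous hf.piecewiseSmooth
  simp only [hf0, hg0, map_zero, sub_zero, e1] at hp
  simp only [comparisonExponent, psExponent, hf0, hg0, sub_zero, map_zero, LinearMap.zero_apply,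
    mul_zero, add_zero, symForm,
    pairing_form_add _ _ hf.continuous hg.piecewiseSmooth,
    pairing_add_left _ hf.continuous hg.continuous hfg.piecewiseSmooth,
    pairing_add_right _ hf.continuous hf.piecewiseSmooth hg.piecewiseSmooth,
    pairing_add_right _ hg.continuous hf.piecewiseSmooth hg.piecewiseSmooth,
    map_add, LinearMap.add_apply, e2, e3, e4]
  linarith

/-- The function on based loops that relates the two cocycles. -/
def comparison (J Q : L →ₗ[ℤ] L →ₗ[ℤ] ℤ) (φ : loopGroup L) : Circle :=
  𝐞 (comparisonExponent J Q (basedLift φ))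

theorem comparison_mul {J b Q D : L →ₗ[ℤ] L →ₗ[ℤ] ℤ} (hQ : ∀ m n, Q m n = Q n m)
    (hD : ∀ m n, J n m + b m n = Q m n + 2 * D m n) {φ γ : loopGroup L}
    (hφ : φ ∈ basedLoops L) (hγ : γ ∈ basedLoops L) :
    comparison J Q φ * comparison J Q γ * (psCocycle J b).toFun φ γ =
      (loopCocycle J).toFun φ γ * comparison J Q (φ + γ) := by
  have hf := isLift_basedLift hφ
  have hg := isLift_basedLift hγ
  have hfg : basedLift (φ + γ) = fun t => basedLift φ t + basedLift γ t := by
    rw [IsLift.basedLift_eq (φ := φ + γ) (hf.add hg)]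
    simp only [basedLift_zero, add_zero, sub_zero]
  obtain ⟨k, hk⟩ := comparisonExponent_add hQ hD hf hg (basedLift_zero φ) (basedLift_zero γ)
  rw [psCocycle_eq J b hf hg, loopCocycle_eq J hf hg, comparison, comparison, comparison, hfg,
    ← AddChar.map_add_eq_mul, ← AddChar.map_add_eq_mul, ← AddChar.map_add_eq_mul, hk,
    AddChar.map_add_eq_mul _ _ (k : ℝ), fourierChar_intCast, mul_one]
  rfl

theorem contDiff_comparison (J Q : L →ₗ[ℤ] L →ₗ[ℤ] ℤ) {A : AddSubgroup (loopGroup L)}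
    (hA : A ≤ basedLoops L) {n : ℕ} {p : EuclideanSpace ℝ (Fin n) → A}
    (hp : IsSmoothFamily L A n p) : ContDiff ℝ ∞ fun u => (comparison J Q (p u) : ℂ) := by
  obtain ⟨F, hF, hlift, P, hP⟩ := hp
  have hl : ∀ u, IsLift L (p u).1.1 (fun t => F (u, t)) := fun u =>
    ⟨hF.comp (by fun_prop), hlift u, P, fun a b h0 hab h1 hq =>
      contDiffOn_slice (hP a b h0 hab h1 hq) u⟩
  -- All loops of the family are based, so the initial values of the lifts are lattice points
  -- depending continuously on `u`.
  have h0 : ∀ u, F (u, 0) = F (0, 0) := fun u =>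
    eq_of_continuous_of_mem (L := L) (hF.comp (by fun_prop : Continuous fun u => (u, (0 : ℝ))))
      (fun u => (hl u).apply_zero_mem (hA (p u).2)) u 0
  have hΔ : ∀ u, F (u, 1) - F (u, 0) = F (0, 1) - F (0, 0) := fun u =>
    eq_of_continuous_of_mem (L := L)
      ((hF.comp (by fun_prop : Continuous fun u => (u, (1 : ℝ)))).sub
        (hF.comp (by fun_prop : Continuous fun u => (u, (0 : ℝ)))))
      (fun u => (hl u).sub_mem) u 0
  have hb : ∀ u, basedLift (p u).1 = fun t => F (u, t) - F (0, 0) := fun u => by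
    rw [(hl u).basedLift_eq, h0]
  have hc : ContDiff ℝ ∞ fun u => comparisonExponent J Q (basedLift (p u).1) := by
    simp only [hb, comparisonExponent, sub_sub_sub_cancel_right, hΔ]
    exact contDiff_const.sub (contDiff_const.mul
      (contDiff_pairing (realForm J) (H := fun q => F q - F (0, 0)) P
        fun a b h0 hab h1 hq => (hP a b h0 hab h1 hq).sub contDiffOn_const))
  simp only [comparison, Real.fourierChar_apply]
  exact ((Complex.ofRealCLM.contDiff.comp (contDiff_const.mul hc)).mul contDiff_const).cexp

/-- On a group of based loops, the extensions given by the loop group cocycle and by the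
Pressley--Segal cocycle are smoothly isomorphic. -/
theorem nonempty_extensionIso_psCocycle (J b : L →ₗ[ℤ] L →ₗ[ℤ] ℤ)
    (hb : ∀ m n : L, b m n + b n m ≡ J m n + J n m [ZMOD 2]) {A : AddSubgroup (loopGroup L)}
    (hA : A ≤ basedLoops L) (S : ∀ n : ℕ, (EuclideanSpace ℝ (Fin n) → A) → Prop)
    (hS : ∀ n p, S n p → IsSmoothFamily L A n p) :
    Nonempty (CircleCocycle.ExtensionIso ((loopCocycle J).restrict A)
      ((psCocycle J b).restrict A) S) := by
  -- Modulo 2 signs are irrelevant, so the antisymmetrization of `Jᵗ + b` is congruent to the sum of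
  -- the two sides of `hb`, which is even.
  obtain ⟨Q, D, hQ, hD⟩ := exists_symm_form (latticeBasis L) (J.flip + b) fun m n => by
    simp only [LinearMap.add_apply, LinearMap.flip_apply]
    have h := (hb m n).dvd
    refine Int.modEq_iff_dvd.2 ?_
    omega
  exact CircleCocycle.nonempty_extensionIso _ _ S (fun φ => comparison J Q φ)
    (fun x y => comparison_mul hQ hD (hA x.2) (hA y.2))
    (fun n p hp => contDiff_comparison J Q hA (hS n p hp))

end Comparison

end LoopTorus

end

theorem mainTheorem7 {V : Type*} [NormedAddCommGroup V] [NormedSpace ℝ V] [FiniteDimensional ℝ V]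
    (L : Submodule ℤ V) [DiscreteTopology L] [IsZLattice ℝ L]
    (J b : L →ₗ[ℤ] L →ₗ[ℤ] ℤ)
    (hb : ∀ m n : L, b m n + b n m ≡ J m n + J n m [ZMOD 2]) :
    (∀ φ ∈ LoopTorus.basedLoops L, ∀ γ ∈ LoopTorus.basedLoops L,
      LoopTorus.HasHolonomy J φ.1 γ.1 ((LoopTorus.loopCocycle J).toFun φ γ)) ∧
    Nonempty (LoopTorus.CircleCocycle.ExtensionIso
      ((LoopTorus.loopCocycle J).restrict (LoopTorus.basedLoops L))
      ((LoopTorus.psCocycle J b).restrict (LoopTorus.basedLoops L))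
      (LoopTorus.IsSmoothFamily L (LoopTorus.basedLoops L))) ∧
    Nonempty (LoopTorus.CircleCocycle.ExtensionIso
      ((LoopTorus.loopCocycle J).restrict (LoopTorus.smoothBasedLoops L))
      ((LoopTorus.psCocycle J b).restrict (LoopTorus.smoothBasedLoops L))
      (LoopTorus.IsSmoothFamily' L (LoopTorus.smoothBasedLoops L))) :=
  ⟨fun _ _ _ hγ => LoopTorus.hasHolonomy_loopCocycle J hγ,
    LoopTorus.nonempty_extensionIso_psCocycle J b hb le_rfl _ fun _ _ hp => hp,
    LoopTorus.nonempty_extensionIso_psCocycle J b hb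
      LoopTorus.smoothBasedLoops_le _
      fun _ _ hp => hp.isSmoothFamily⟩
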